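/- Let $d,n\ge 0$ be integers, $\mathcal A\subset\mathbb Z^d$ a finite set, $w=(w_a)_{a\in\mathcal A}$ positive real weights, $\mathcal B=(b_a)_{a\in\mathcal A}$ control points in $\mathbb R^n$, and $\lambda:\mathcal A\to\mathbb R$ any function. Definitions. For a finite set $\mathcal F\subset\mathbb Z^d$ let $\Delta_{\mathcal F}=\operatorname{conv}\mathcal F$. For each facet $e$ of $\Delta_{\mathcal F}$ let $h_e$ be the primitive integral affine function of $e$: the affine function on the affine span of $\mathcal F$ that is nonnegative on $\Delta_{\mathcal F}$, vanishes on $e$, and maps the set of integer points of the affine span onto $\mathbb Z$. (If $\Delta_{\mathcal F}$ is full-dimensional, this means that $h_e$ has integer coefficients with no common factor. A single point has no facets.) For $a\in\mathcal F$ put $\beta_{a,\mathcal F}(x)=\prod_e h_e(x)^{h_e(a)}$ for $x\in\Delta_{\mathcal F}$, with $0^0=1$. The toric Bézier patch $Y_{\mathcal F,w,\mathcal B}$ is the image of $\Delta_{\mathcal F}$ under $$F_{\mathcal F,w,\mathcal B}(x)=\frac{\sum_{a\in\mathcal F}w_a\,\beta_{a,\mathcal F}(x)\,b_a}{\sum_{a\in\mathcal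 F}w_a\,\beta_{a,\mathcal F}(x)}.$$ When the control points are the standard basis vectors $e_a$ of $\mathbb R^{\mathcal A}$, the vertices of the standard simplex, write $X_{\mathcal F,w}$ for this patch ($\mathcal F\subset\mathcal A$). Let $P_\lambda=\operatorname{conv}\{(a,\lambda(a)) : a\in\mathcal A\}\subset\mathbb R^{d+1}$. An upper face of $P_\lambda$ is a nonempty face having an outward normal vector with positive last coordinate. The regular decomposition $\mathcal S_\lambda$ of $\mathcal A$ induced by $\lambda$ is the collection of the sets $\{a\in\mathcal A : (a,\lambda(a))\in Q\}$, where $Q$ runs over the upper faces of $P_\lambda$. The regular control surfaces are $$Y_{\mathcal A,w,\mathcal B}(\mathcal S_\lambda)=\bigcup_{\mathcal F\in\mathcal S_\lambda}Y_{\mathcal F,w|_{\mathcal F},\mathcal B|_{\mathcal F}},\qquad X_{\mathcal A,w}(\mathcal S_\lambda)=\bigcup_{\mathcal F\in\mathcal S_\lambda}X_{\mathcal F,w|_{\mathcal F}}.$$ For $t>0$ let $w_\lambda(t)=(t^{\lambda(a)}w_a)_{a\in\mathcal A}$. Two sets are within Hausdorff distance $\varepsilon$ if every point of each is at distance at most $\varepsilon$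 from some point of the other. Theorem. For every $\varepsilon>0$ there is $M>0$ such that for all $t\ge M$ the patch $Y_{\mathcal A,w_\lambda(t),\mathcal B}$ and the regular control surface $Y_{\mathcal A,w,\mathcal B}(\mathcal S_\lambda)$ are within Hausdorff distance $\varepsilon$; that is, $$\lim_{t\to\infty}Y_{\mathcal A,w_\lambda(t),\mathcal B}=Y_{\mathcal A,w,\mathcal B}(\mathcal S_\lambda).$$ In the same sense, in the standard simplex of $\mathbb R^{\mathcal A}$, $$\lim_{t\to\infty}X_{\mathcal A,w_\lambda(t)}=X_{\mathcal A,w}(\mathcal S_\lambda).$$ -/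

import Mathlib

/-- An integer point of `ℤ^d`, viewed as a point of `ℝ^d`. -/
def latticePt {d : ℕ} (a : Fin d → ℤ) : Fin d → ℝ := fun i => (a i : ℝ)

/-- The set `A ⊂ ℤ^d`, viewed as a subset of `ℝ^d`. -/
def latticeSet {d : ℕ} (A : Finset (Fin d → ℤ)) : Set (Fin d → ℝ) :=
  latticePt '' (A : Set (Fin d → ℤ))

/-- The lattice polytope `Δ_A`, the convex hull of `A`. -/
def latticePolytope {d : ℕ} (A : Finset (Fin d → ℤ)) : Set (Fin d → ℝ) :=
  convexHull ℝ (latticeSet A)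

/-- `G ⊆ A` is the set of points of `A` lying on a facet of `Δ_A`: it is cut out of `A` by a
supporting hyperplane of `Δ_A`, and its dimension is one less than that of `Δ_A`.
Neither `A` nor `G` has to be full-dimensional; a single point has no facets. -/
structure IsFacet {d : ℕ} (A G : Finset (Fin d → ℤ)) : Prop where
  subset : G ⊆ A
  nonempty : G.Nonempty
  exposed : ∃ l : (Fin d → ℝ) →ᵃ[ℝ] ℝ,
    (∀ a ∈ A, 0 ≤ l (latticePt a)) ∧ ∀ a ∈ A, (l (latticePt a) = 0 ↔ a ∈ G)
  codim_one : Module.finrank ℝ (vectorSpan ℝ (latticeSet G)) + 1 =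
    Module.finrank ℝ (vectorSpan ℝ (latticeSet A))

/-- `h ≥ 0` is the primitive integral inequality of the facet `G` of `Δ_A`: `h` is affine,
nonnegative on `Δ_A`, vanishes exactly on the facet, and on the lattice of integer points of the
affine span of `A` it takes exactly the integers as values. When `Δ_A` is full-dimensional the last
condition says that `h` has integer coefficients without a common factor. In general these
conditions determine `h` on the affine span of `A`. -/
structure IsFacetForm {d : ℕ} (A G : Finset (Fin d → ℤ)) (h : (Fin d → ℝ) →ᵃ[ℝ] ℝ) : Prop where
  nonneg : ∀ x ∈ latticePolytope A, 0 ≤ h x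
  eq_zero_iff : ∀ a ∈ A, (h (latticePt a) = 0 ↔ a ∈ G)
  primitive : {r : ℝ | ∃ z : Fin d → ℤ,
      latticePt z ∈ affineSpan ℝ (latticeSet A) ∧ h (latticePt z) = r} =
    Set.range (fun k : ℤ => (k : ℝ))

/-- If the integer point `a₀` lies off the affine span of `G ∋ g`, some integral affine form
vanishes on `G` and is positive at `a₀`. -/
theorem exists_integer_form {d : ℕ} {G : Finset (Fin d → ℤ)}
    {g a₀ : Fin d → ℤ} (hg : g ∈ G)
    (hnot : latticePt a₀ - latticePt g ∉ vectorSpan ℝ (latticeSet G)) :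
    ∃ n : Fin d → ℤ, (∀ a ∈ G, ∑ i, n i * (a i - g i) = 0) ∧ 0 < ∑ i, n i * (a₀ i - g i) := by
  classical
  let q : (Fin d → ℤ) → (Fin d → ℚ) := fun a i => (a i : ℚ)
  let ι : (Fin d → ℚ) →ₗ[ℚ] (Fin d → ℝ) :=
    { toFun := fun x i => (x i : ℝ)
      map_add' := by intro x y; ext i; simp
      map_smul' := by intro c x; ext i; simp [Rat.smul_def] }
  let W : Submodule ℚ (Fin d → ℚ) := Submodule.span ℚ ((fun a => q a - q g) '' (G : Set _))
  have hW : q a₀ - q g ∉ W := by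
    intro hmem
    apply hnot
    have hle : W ≤ ((vectorSpan ℝ (latticeSet G)).restrictScalars ℚ).comap ι := by
      refine Submodule.span_le.2 ?_
      rintro _ ⟨a, ha, rfl⟩
      have : latticePt a -ᵥ latticePt g ∈ vectorSpan ℝ (latticeSet G) :=
        vsub_mem_vectorSpan ℝ ⟨a, ha, rfl⟩ ⟨g, hg, rfl⟩
      have e : ι (q a - q g) = latticePt a - latticePt g := by
        ext i; simp [ι, q, latticePt]
      simpa [e] using this
    have := hle hmem
    have e : ι (q a₀ - q g) = latticePt a₀ - latticePt g := by
      ext i; simp [ι, q, latticePt]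
    simpa [e] using this
  obtain ⟨φ, hφ, hφW⟩ := Submodule.exists_le_ker_of_notMem hW
  obtain ⟨⟨D, hD⟩, hDi⟩ := IsLocalization.exist_integer_multiples_of_finite
    (nonZeroDivisors ℤ) (fun i : Fin d => φ (Pi.single i 1))
  choose m hm using hDi
  have hD0 : D ≠ 0 := nonZeroDivisors.ne_zero hD
  have hval : ∀ a : Fin d → ℤ, ((∑ i, m i * (a i - g i) : ℤ) : ℚ) = D * φ (q a - q g) := by
    intro a
    rw [LinearMap.pi_apply_eq_sum_univ φ (q a - q g)]
    push_cast
    rw [Finset.mul_sum]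
    refine Finset.sum_congr rfl fun i _ => ?_
    have := hm i
    simp only [algebraMap_int_eq, eq_intCast, zsmul_eq_mul] at this
    rw [this]
    have e : (fun j => if i = j then (1 : ℚ) else 0) = Pi.single i 1 := by
      ext j; simp [Pi.single_apply, eq_comm]
    simp only [e, q, Pi.sub_apply, smul_eq_mul]
    ring
  have h1 : ∀ a ∈ G, ∑ i, m i * (a i - g i) = 0 := by
    intro a ha
    have : φ (q a - q g) = 0 := hφW (Submodule.subset_span ⟨a, ha, rfl⟩)
    have h2 := hval a
    rw [this, mul_zero] at h2
    exact_mod_cast h2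
  have h2 : ∑ i, m i * (a₀ i - g i) ≠ 0 := by
    intro h0
    have h3 := hval a₀
    rw [h0] at h3
    have : (D : ℚ) ≠ 0 := by exact_mod_cast hD0
    simp_all
  rcases lt_or_gt_of_ne h2 with h | h
  · refine ⟨fun i => - m i, fun a ha => ?_, ?_⟩
    · simp [h1 a ha]
    · simpa using h
  · exact ⟨m, h1, h⟩

/-- Every facet has a primitive integral inequality. -/
theorem exists_isFacetForm {d : ℕ} {A G : Finset (Fin d → ℤ)} (hG : IsFacet A G) :
    ∃ h : (Fin d → ℝ) →ᵃ[ℝ] ℝ, IsFacetForm A G h := by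
  classical
  obtain ⟨g, hg⟩ := hG.nonempty
  obtain ⟨l, hl0, hlG⟩ := hG.exposed
  have hgA := hG.subset hg
  have hGA : latticeSet G ⊆ latticeSet A := Set.image_mono (by exact_mod_cast hG.subset)
  have hle : vectorSpan ℝ (latticeSet G) ≤ vectorSpan ℝ (latticeSet A) := vectorSpan_mono ℝ hGA
  have hg' : latticePt g ∈ latticeSet G := ⟨g, hg, rfl⟩
  have hlg : l (latticePt g) = 0 := (hlG g hgA).2 hg
  have hlin : ∀ x y : Fin d → ℝ, l.linear (x - y) = l x - l y := fun x y => l.linearMap_vsub x y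
  -- the linear part vanishes on the span of the facet
  have hker : vectorSpan ℝ (latticeSet G) ≤ LinearMap.ker l.linear := by
    rw [vectorSpan_eq_span_vsub_set_right ℝ hg', Submodule.span_le]
    rintro _ ⟨_, ⟨a, ha, rfl⟩, rfl⟩
    have : l (latticePt a) = 0 := (hlG a (hG.subset ha)).2 ha
    simp [hlin, this, hlg]
  obtain ⟨a₀, ha₀, ha₀G⟩ : ∃ a ∈ A, a ∉ G := by
    by_contra! hc
    have : G = A := Finset.Subset.antisymm hG.subset hc
    have := hG.codim_one
    subst_vars
    omega
  have hl₀ : 0 < l (latticePt a₀) :=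
    lt_of_le_of_ne (hl0 a₀ ha₀) fun h => ha₀G ((hlG a₀ ha₀).1 h.symm)
  have hnot : latticePt a₀ - latticePt g ∉ vectorSpan ℝ (latticeSet G) := by
    intro hmem
    have := hker hmem
    rw [LinearMap.mem_ker, hlin, hlg] at this
    linarith
  obtain ⟨n, hnG, hn0⟩ := exists_integer_form hg hnot
  let f : (Fin d → ℝ) →ₗ[ℝ] ℝ := ∑ i, (n i : ℝ) • LinearMap.proj i
  have hf : ∀ x, f x = ∑ i, (n i : ℝ) * x i := by intro x; simp [f]
  have hfz : ∀ z w : Fin d → ℤ,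
      f (latticePt z - latticePt w) = ((∑ i, n i * (z i - w i) : ℤ) : ℝ) := by
    intro z w; rw [hf]; push_cast; simp [latticePt]
  have hfker : vectorSpan ℝ (latticeSet G) ≤ LinearMap.ker f := by
    rw [vectorSpan_eq_span_vsub_set_right ℝ hg', Submodule.span_le]
    rintro _ ⟨_, ⟨a, ha, rfl⟩, rfl⟩
    have := hnG a ha
    simp only [vsub_eq_sub, SetLike.mem_coe, LinearMap.mem_ker]
    rw [hfz, this]; simp
  have hdec : vectorSpan ℝ (latticeSet A) ≤
      vectorSpan ℝ (latticeSet G) ⊔ Submodule.span ℝ {latticePt a₀ - latticePt g} := by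
    have hv : latticePt a₀ - latticePt g ∈ vectorSpan ℝ (latticeSet A) :=
      vsub_mem_vectorSpan ℝ ⟨a₀, ha₀, rfl⟩ ⟨g, hgA, rfl⟩
    have hsup : vectorSpan ℝ (latticeSet G) ⊔ Submodule.span ℝ {latticePt a₀ - latticePt g} ≤
        vectorSpan ℝ (latticeSet A) :=
      sup_le hle ((Submodule.span_singleton_le_iff_mem _ _).2 hv)
    have hlt : vectorSpan ℝ (latticeSet G) <
        vectorSpan ℝ (latticeSet G) ⊔ Submodule.span ℝ {latticePt a₀ - latticePt g} := by
      refine lt_of_le_of_ne le_sup_left fun h => hnot ?_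
      rw [h]
      exact (le_sup_right : _ ≤ vectorSpan ℝ (latticeSet G) ⊔ _)
        (Submodule.mem_span_singleton_self _)
    refine (Submodule.eq_of_le_of_finrank_le hsup ?_).ge
    have := Submodule.finrank_lt_finrank_of_lt hlt
    have := hG.codim_one
    omega
  -- on the directions of the affine span both linear parts are proportional
  have hprop : ∀ v ∈ vectorSpan ℝ (latticeSet A),
      f v * l (latticePt a₀) = l.linear v * f (latticePt a₀ - latticePt g) := by
    intro v hv
    obtain ⟨u, hu, s, hs, rfl⟩ := Submodule.mem_sup.1 (hdec hv)
    obtain ⟨r, rfl⟩ := Submodule.mem_span_singleton.1 hs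
    have e1 : f u = 0 := hfker hu
    have e2 : l.linear u = 0 := hker hu
    rw [map_add, map_add, map_smul, map_smul, e1, e2, hlin, hlg]
    simp; ring
  have hf0 : 0 < f (latticePt a₀ - latticePt g) := by rw [hfz]; exact_mod_cast hn0
  let Λ : AddSubgroup (Fin d → ℤ) :=
    { carrier := {z | latticePt z ∈ vectorSpan ℝ (latticeSet A)}
      zero_mem' := by
        have : latticePt (0 : Fin d → ℤ) = 0 := by ext i; simp [latticePt]
        simp [this]
      add_mem' := by
        intro a b ha hb
        have : latticePt (a + b) = latticePt a + latticePt b := by ext i; simp [latticePt]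
        simp only [Set.mem_ofPred_eq, this] at *
        exact Submodule.add_mem _ ha hb
      neg_mem' := by
        intro a ha
        have : latticePt (-a) = - latticePt a := by ext i; simp [latticePt]
        simp only [Set.mem_ofPred_eq, this] at *
        exact Submodule.neg_mem _ ha }
  let N : (Fin d → ℤ) →+ ℤ :=
    { toFun := fun z => ∑ i, n i * z i
      map_zero' := by simp
      map_add' := by intro x y; simp [mul_add, Finset.sum_add_distrib] }
  obtain ⟨m', hm'⟩ := Int.subgroup_cyclic (Λ.map N)
  have hΛmem : ∀ z w : Fin d → ℤ, z - w ∈ Λ ↔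
      latticePt z - latticePt w ∈ vectorSpan ℝ (latticeSet A) := by
    intro z w
    have : latticePt (z - w) = latticePt z - latticePt w := by ext i; simp [latticePt]
    rw [← this]
    rfl
  have hfN : ∀ z w : Fin d → ℤ, f (latticePt z - latticePt w) = ((N (z - w) : ℤ) : ℝ) := by
    intro z w; rw [hfz]; simp [N]
  have hmem₀ : latticePt a₀ ∈ latticeSet A := ⟨a₀, ha₀, rfl⟩
  have hmemg : latticePt g ∈ latticeSet A := ⟨g, hgA, rfl⟩
  have hm0 : m' ≠ 0 := by
    rintro rfl
    have h1 : N (a₀ - g) ∈ Λ.map N :=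
      ⟨_, (hΛmem a₀ g).2 (vsub_mem_vectorSpan ℝ hmem₀ hmemg), rfl⟩
    rw [hm', ← AddSubgroup.zmultiples_eq_closure, Int.mem_zmultiples_iff, zero_dvd_iff] at h1
    have : N (a₀ - g) = 0 := h1
    rw [hfN, this] at hf0
    simp at hf0
  set m : ℤ := |m'| with hmdef
  have hmpos : 0 < m := abs_pos.2 hm0
  have hmR : (0 : ℝ) < m := by exact_mod_cast hmpos
  have hmem : ∀ k : ℤ, k ∈ Λ.map N ↔ m ∣ k := by
    intro k
    rw [hm', ← AddSubgroup.zmultiples_eq_closure, Int.mem_zmultiples_iff, abs_dvd]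
  let h : (Fin d → ℝ) →ᵃ[ℝ] ℝ :=
    ((m : ℝ)⁻¹ • f).toAffineMap - AffineMap.const ℝ _ ((m : ℝ)⁻¹ * f (latticePt g))
  have hh : ∀ x, h x = (m : ℝ)⁻¹ * f (x - latticePt g) := by
    intro x; simp [h, mul_sub]
  have hval : ∀ x, x - latticePt g ∈ vectorSpan ℝ (latticeSet A) →
      h x = ((m : ℝ)⁻¹ * f (latticePt a₀ - latticePt g) / l (latticePt a₀)) * l x := by
    intro x hx
    have := hprop _ hx
    rw [hlin, hlg, sub_zero] at this
    rw [hh]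
    field_simp
    linarith
  have hc : 0 < (m : ℝ)⁻¹ * f (latticePt a₀ - latticePt g) / l (latticePt a₀) := by positivity
  have hvA : ∀ a ∈ A, h (latticePt a) =
      ((m : ℝ)⁻¹ * f (latticePt a₀ - latticePt g) / l (latticePt a₀)) * l (latticePt a) :=
    fun a ha => hval _ (vsub_mem_vectorSpan ℝ ⟨a, ha, rfl⟩ ⟨g, hgA, rfl⟩)
  refine ⟨h, ⟨?_, ?_, ?_⟩⟩
  · have hconv : Convex ℝ {x | 0 ≤ h x} := by
      have := (convex_Ici (𝕜 := ℝ) (0 : ℝ)).affine_preimage h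
      exact this
    intro x hx
    refine convexHull_min ?_ hconv hx
    rintro _ ⟨a, ha, rfl⟩
    change 0 ≤ h (latticePt a)
    rw [hvA a ha]
    exact mul_nonneg hc.le (hl0 a ha)
  · intro a ha
    rw [hvA a ha, mul_eq_zero, or_iff_right hc.ne', hlG a ha]
  · have hspan : ∀ z : Fin d → ℤ, latticePt z ∈ affineSpan ℝ (latticeSet A) ↔ z - g ∈ Λ := by
      intro z
      rw [hΛmem, ← direction_affineSpan, ← vsub_eq_sub]
      exact (AffineSubspace.vsub_right_mem_direction_iff_mem (mem_affineSpan ℝ hmemg) _).symm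
    ext r
    constructor
    · rintro ⟨z, hz, rfl⟩
      obtain ⟨k, hk⟩ := (hmem _).1 (⟨_, (hspan z).1 hz, rfl⟩ : N (z - g) ∈ Λ.map N)
      refine ⟨k, ?_⟩
      rw [hh, hfN, hk]
      push_cast
      field_simp
    · rintro ⟨k, rfl⟩
      obtain ⟨z, hz, hzk⟩ := (hmem (m * k)).2 (dvd_mul_right _ _)
      refine ⟨z + g, (hspan _).2 (by simpa using hz), ?_⟩
      rw [hh, hfN, add_sub_cancel_right, hzk]
      push_cast
      field_simp

open Classical in
/-- The primitive integral affine form `h_G` of the facet `G` of `Δ_A`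
(`0` if `G` is not a facet). -/
noncomputable def facetForm {d : ℕ} (A G : Finset (Fin d → ℤ)) : (Fin d → ℝ) →ᵃ[ℝ] ℝ :=
  if hG : IsFacet A G then (exists_isFacetForm hG).choose else 0

open Classical in
/-- The toric basis function `β_{a,A}(x) = ∏_G h_G(x) ^ h_G(a)`, the product over the facets of
`Δ_A`; as usual `0 ^ 0 = 1`. -/
noncomputable def toricBasis {d : ℕ} (A : Finset (Fin d → ℤ)) (a : Fin d → ℤ)
    (x : Fin d → ℝ) : ℝ :=
  ∏ G ∈ A.powerset.filter (fun G => IsFacet A G),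
    (facetForm A G x) ^ (facetForm A G (latticePt a))

/-- The map `F_{A,w,B}` parametrizing a toric Bézier patch of shape `A`. Only the weights `w a` and
control points `b a` with `a ∈ A` matter, so that restriction to a subset of `A` is automatic. -/
noncomputable def toricMap {d : ℕ} {E : Type*} [AddCommGroup E] [Module ℝ E]
    (A : Finset (Fin d → ℤ)) (w : (Fin d → ℤ) → ℝ) (b : (Fin d → ℤ) → E)
    (x : Fin d → ℝ) : E :=
  (∑ a ∈ A, w a * toricBasis A a x)⁻¹ • ∑ a ∈ A, (w a * toricBasis A a x) • b a

/-- The toric Bézier patch `Y_{A,w,B}`: the image of `Δ_A` under `F_{A,w,B}`. -/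
noncomputable def toricPatch {d : ℕ} {E : Type*} [AddCommGroup E] [Module ℝ E]
    (A : Finset (Fin d → ℤ)) (w : (Fin d → ℤ) → ℝ) (b : (Fin d → ℤ) → E) : Set E :=
  toricMap A w b '' latticePolytope A

/-- The control surface `Y_{A,w,B}(S)` of a decomposition `S`: the union of the patches
`Y_{F,w|F,B|F}` over the faces `F` of `S`. -/
noncomputable def controlSurface {d : ℕ} {E : Type*} [AddCommGroup E] [Module ℝ E]
    (S : Set (Finset (Fin d → ℤ))) (w : (Fin d → ℤ) → ℝ) (b : (Fin d → ℤ) → E) : Set E :=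
  ⋃ F ∈ S, toricPatch F w b

/-- The lift `(a, lam a) ∈ ℝ^d × ℝ` of `a`. -/
def liftPt {d : ℕ} (lam : (Fin d → ℤ) → ℝ) (a : Fin d → ℤ) : (Fin d → ℝ) × ℝ :=
  (latticePt a, lam a)

/-- The convex hull `P_lam` of the lifted points. -/
def liftedPolytope {d : ℕ} (A : Finset (Fin d → ℤ)) (lam : (Fin d → ℤ) → ℝ) :
    Set ((Fin d → ℝ) × ℝ) :=
  convexHull ℝ (liftPt lam '' (A : Set (Fin d → ℤ)))

/-- `Q` is an upper face of `P_lam`: a nonempty face that has an outward normal vector `(v, s)`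
with last coordinate `s > 0`. When `P_lam` is full-dimensional these are the upper facets and all
faces lying on them. -/
def IsUpperFace {d : ℕ} (A : Finset (Fin d → ℤ)) (lam : (Fin d → ℤ) → ℝ)
    (Q : Set ((Fin d → ℝ) × ℝ)) : Prop :=
  Q.Nonempty ∧ ∃ (v : Fin d → ℝ) (s : ℝ), 0 < s ∧
    Q = {p | p ∈ liftedPolytope A lam ∧
      ∀ q ∈ liftedPolytope A lam, v ⬝ᵥ q.1 + s * q.2 ≤ v ⬝ᵥ p.1 + s * p.2}

/-- The regular decomposition `S_lam` of `A`: its faces are the sets of those points of `A`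
whose lifts lie on a common upper face of `P_lam`. -/
def regularDecomposition {d : ℕ} (A : Finset (Fin d → ℤ)) (lam : (Fin d → ℤ) → ℝ) :
    Set (Finset (Fin d → ℤ)) :=
  {F | ∃ Q, IsUpperFace A lam Q ∧ ∀ a, a ∈ F ↔ a ∈ A ∧ liftPt lam a ∈ Q}

/-- The weights `w_lam(t) = (t ^ lam(a) * w_a)` of the toric degeneration. -/
noncomputable def degenerationWeights {d : ℕ} (w lam : (Fin d → ℤ) → ℝ) (t : ℝ) :
    (Fin d → ℤ) → ℝ :=
  fun a => t ^ lam a * w a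

/-- The vertex `e_a` of the standard simplex in `ℝ^A`. With these as control points the toric patch
of shape `A` is the translated toric variety `X_{A,w}`. -/
noncomputable def simplexVertex {d : ℕ} (A : Finset (Fin d → ℤ)) (a : Fin d → ℤ) :
    EuclideanSpace ℝ A :=
  WithLp.toLp 2 fun c => if (c : Fin d → ℤ) = a then 1 else 0

/-- `X` and `Y` are within Hausdorff distance `ε`. -/
def WithinHausdorffDistance {E : Type*} [PseudoMetricSpace E] (ε : ℝ) (X Y : Set E) : Prop :=
  (∀ x ∈ X, ∃ y ∈ Y, dist x y ≤ ε) ∧ (∀ y ∈ Y, ∃ x ∈ X, dist y x ≤ ε)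

/-- `lim_{t → ∞} X(t) = Y` with respect to the Hausdorff distance. -/
def HausdorffLimit {E : Type*} [PseudoMetricSpace E] (X : ℝ → Set E) (Y : Set E) : Prop :=
  ∀ ε > 0, ∃ M > 0, ∀ t ≥ M, WithinHausdorffDistance ε (X t) Y

/-! Where all facet forms are positive, `toricBasis A a x` is the exponential of `∑ log h_G(x) ·
h_G(a)`, which is affine in `a`. Such points therefore map to averages of the control points with
weights `w a * exp (φ a)`, `φ` affine: the `torusOrbit`. Conversely every affine `φ` arises in this
way up to a constant, by minimizing a convex entropy (`exists_sum_log_facetForm_eq`). So a patch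
lies between its orbit and the closure of the orbit, and it suffices to compare orbits.

The weights at time `t` only add `log t * lam` to the exponent. A face `F` of the decomposition
comes with `χ` affine and `s > 0` such that `χ + s * lam ≤ 0` on `A`, with equality exactly on `F`.
Adding a large multiple of this function to an exponent kills all weights off `F`, so each orbit
point of `F` is a limit (`eventually_exists_torusOrbit_dist_lt`).

In the other direction, let normalized weights converge as `t → ∞`, and let `F` be the support of
the limit. On `F` the exponents `φ + log t * lam` converge, which forces `lam` to be affine on `F`;
off `F` they tend to `-∞`. Correcting one of them by a bounded affine form shows that `F` is a face
(`exists_face_of_tendsto`). Compactness gives uniformity in both directions. -/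

open Filter Topology

/-! ### Facet inequalities of lattice polytopes -/

section Polytope

variable {d : ℕ} {A : Finset (Fin d → ℤ)}

theorem latticePt_mem_latticePolytope {a : Fin d → ℤ} (ha : a ∈ A) :
    latticePt a ∈ latticePolytope A :=
  subset_convexHull ℝ _ ⟨a, ha, rfl⟩

theorem convex_latticePolytope : Convex ℝ (latticePolytope A) := convex_convexHull ℝ _

theorem isCompact_latticePolytope : IsCompact (latticePolytope A) :=
  ((A.finite_toSet).image _).isCompact_convexHull ℝ

/-- An affine form on a lattice polytope is bounded below by its value at some vertex. -/
theorem exists_apply_le_of_mem_latticePolytope (l : (Fin d → ℝ) →ᵃ[ℝ] ℝ) {x : Fin d → ℝ}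
    (hx : x ∈ latticePolytope A) : ∃ a ∈ A, l (latticePt a) ≤ l x := by
  by_contra! hc
  have hconv : Convex ℝ {y | l x < l y} := (convex_Ioi (𝕜 := ℝ) (l x)).affine_preimage l
  have : x ∈ {y | l x < l y} := by
    refine convexHull_min ?_ hconv hx
    rintro _ ⟨a, ha, rfl⟩
    exact hc a ha
  exact lt_irrefl (l x) this

theorem AffineSubspace.exists_affineMap_eq_zero_ne_zero {E : Type*} [AddCommGroup E] [Module ℝ E]
    {S : AffineSubspace ℝ E} {p q : E} (hq : q ∈ S) (hp : p ∉ S) :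
    ∃ m : E →ᵃ[ℝ] ℝ, (∀ x ∈ S, m x = 0) ∧ m p ≠ 0 := by
  have hpq : p - q ∉ S.direction := fun h =>
    hp ((AffineSubspace.vsub_right_mem_direction_iff_mem hq p).1 h)
  obtain ⟨f, hf, hS⟩ := Submodule.exists_le_ker_of_notMem hpq
  refine ⟨f.toAffineMap - AffineMap.const ℝ _ (f q), fun x hx => ?_, ?_⟩
  · have : f (x - q) = 0 := hS (AffineSubspace.vsub_mem_direction hx hq)
    simpa using this
  · simpa using hf

theorem AffineMap.eq_zero_of_mem_affineSpan {E : Type*} [AddCommGroup E] [Module ℝ E]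
    {s : Set E} (m : E →ᵃ[ℝ] ℝ) (hm : ∀ x ∈ s, m x = 0) {y : E} (hy : y ∈ affineSpan ℝ s) :
    m y = 0 := by
  have hle : affineSpan ℝ s ≤ (AffineSubspace.mk' (0 : ℝ) ⊥).comap m := by
    rw [affineSpan_le]
    intro x hx
    simp [hm x hx]
  have := hle hy
  simpa using this

theorem AffineMap.finsetSum_apply {ι E : Type*} [AddCommGroup E] [Module ℝ E] (S : Finset ι)
    (f : ι → E →ᵃ[ℝ] ℝ) (x : E) : (∑ i ∈ S, f i) x = ∑ i ∈ S, f i x :=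
  map_sum ({ toFun := fun g : E →ᵃ[ℝ] ℝ => g x
             map_zero' := rfl
             map_add' := fun _ _ => rfl } : (E →ᵃ[ℝ] ℝ) →+ ℝ) f S

theorem finrank_vectorSpan_lt_of_affineSpan_lt {s t : Set (Fin d → ℝ)} (hs : s.Nonempty)
    (h : affineSpan ℝ s < affineSpan ℝ t) :
    Module.finrank ℝ (vectorSpan ℝ s) < Module.finrank ℝ (vectorSpan ℝ t) := by
  have := AffineSubspace.direction_lt_of_nonempty h (hs.mono (subset_affineSpan ℝ s))
  rw [direction_affineSpan, direction_affineSpan] at this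
  exact Submodule.finrank_lt_finrank_of_lt this

theorem affineSpan_insert_eq_of_finrank {s t : Set (Fin d → ℝ)} (hst : s ⊆ t) {a : Fin d → ℝ}
    (hs : s.Nonempty) (ha : a ∈ affineSpan ℝ t) (has : a ∉ affineSpan ℝ s)
    (hdim : Module.finrank ℝ (vectorSpan ℝ t) ≤ Module.finrank ℝ (vectorSpan ℝ s) + 1) :
    affineSpan ℝ (insert a s) = affineSpan ℝ t := by
  have hle : affineSpan ℝ (insert a s) ≤ affineSpan ℝ t := by
    rw [affineSpan_le]
    exact Set.insert_subset ha (hst.trans (subset_affineSpan ℝ t))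
  have hlt : affineSpan ℝ s < affineSpan ℝ (insert a s) := by
    refine lt_of_le_of_ne (affineSpan_mono ℝ (Set.subset_insert a s)) fun h => has ?_
    rw [h]
    exact mem_affineSpan ℝ (Set.mem_insert a s)
  have hne : (affineSpan ℝ s : Set (Fin d → ℝ)).Nonempty := hs.mono (subset_affineSpan ℝ s)
  have hlt' := finrank_vectorSpan_lt_of_affineSpan_lt hs hlt
  refine AffineSubspace.eq_of_direction_eq_of_nonempty_of_le ?_
    (hne.mono hlt.le) hle
  have hle' := AffineSubspace.direction_le hle
  rw [direction_affineSpan, direction_affineSpan] at hle' ⊢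
  exact Submodule.eq_of_le_of_finrank_le hle' (by omega)

/-- The affine form `l` is nonnegative on `A` and vanishes exactly on the nonempty set `H ⊆ A`. -/
structure SupportsOn (A H : Finset (Fin d → ℤ)) (l : (Fin d → ℝ) →ᵃ[ℝ] ℝ) : Prop where
  subset : H ⊆ A
  nonempty : H.Nonempty
  nonneg : ∀ a ∈ A, 0 ≤ l (latticePt a)
  eq_zero_iff : ∀ a ∈ A, (l (latticePt a) = 0 ↔ a ∈ H)

/-- Rotating a supporting hyperplane about the face `H` until it hits another point of `A`. -/
theorem SupportsOn.exists_larger {H : Finset (Fin d → ℤ)} {l m : (Fin d → ℝ) →ᵃ[ℝ] ℝ}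
    (hl : SupportsOn A H l) (hm : ∀ a ∈ H, m (latticePt a) = 0)
    (hneg : ∃ b ∈ A, m (latticePt b) < 0) :
    ∃ H' s, SupportsOn A H' (l + (s : ℝ) • m) ∧ H.card < H'.card := by
  classical
  obtain ⟨b, hbB, hmin⟩ := (A.filter fun b => m (latticePt b) < 0).exists_min_image
    (fun b => l (latticePt b) / -(m (latticePt b)))
    (by obtain ⟨b, hb, h⟩ := hneg; exact ⟨b, Finset.mem_filter.2 ⟨hb, h⟩⟩)
  obtain ⟨hb, hmb⟩ := Finset.mem_filter.1 hbB
  -- The least ratio is the first time at which `l + s • m` reaches zero where `m < 0`, so the form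
  -- is still nonnegative on `A`. The new zero `b` is not in `H`, because `m` vanishes there.
  set s := l (latticePt b) / -(m (latticePt b)) with hs
  have hs0 : 0 ≤ s := div_nonneg (hl.nonneg b hb) (by linarith)
  have hval : ∀ x, (l + s • m) x = l x + s * m x := fun x => by simp
  have hzero : (l + s • m) (latticePt b) = 0 := by
    have := hmb.ne
    rw [hval, hs]
    field_simp
    ring
  have hsub : H ⊆ A.filter fun a => (l + s • m) (latticePt a) = 0 := by
    intro a ha
    refine Finset.mem_filter.2 ⟨hl.subset ha, ?_⟩
    rw [hval, hm a ha, (hl.eq_zero_iff a (hl.subset ha)).2 ha]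
    simp
  refine ⟨A.filter fun a => (l + s • m) (latticePt a) = 0, s,
    ⟨Finset.filter_subset _ _, hl.nonempty.mono hsub, fun a ha => ?_, fun a ha => ?_⟩, ?_⟩
  · rw [hval]
    rcases lt_or_ge (m (latticePt a)) 0 with h | h
    · have := hmin a (Finset.mem_filter.2 ⟨ha, h⟩)
      rw [le_div_iff₀ (by linarith)] at this
      linarith
    · have := hl.nonneg a ha
      positivity
  · rw [Finset.mem_filter, and_iff_right ha]
  · refine Finset.card_lt_card ⟨hsub, fun h => ?_⟩
    have := hm b (h (Finset.mem_filter.2 ⟨hb, hzero⟩))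
    linarith

theorem facetForm_spec {G : Finset (Fin d → ℤ)} (hG : IsFacet A G) :
    IsFacetForm A G (facetForm A G) := by
  rw [facetForm, dif_pos hG]
  exact (exists_isFacetForm hG).choose_spec

theorem IsFacet.exists_notMem {G : Finset (Fin d → ℤ)} (hG : IsFacet A G) : ∃ a ∈ A, a ∉ G := by
  by_contra! hc
  have : G = A := Finset.Subset.antisymm hG.subset hc
  have := hG.codim_one
  subst_vars
  omega

/-- A point of the affine span at which all facet forms are nonnegative lies in the polytope. -/
theorem mem_latticePolytope_of_facetForm_nonneg {y : Fin d → ℝ}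
    (hy : y ∈ affineSpan ℝ (latticeSet A)) (h : ∀ G, IsFacet A G → 0 ≤ facetForm A G y) :
    y ∈ latticePolytope A := by
  classical
  by_contra hyA
  have hne : A.Nonempty := by
    rcases A.eq_empty_or_nonempty with rfl | h
    · simp [latticeSet, AffineSubspace.notMem_bot] at hy
    · exact h
  -- Hahn–Banach gives a face with a supporting form negative at `y`. One with the most points turns
  -- out to be a facet.
  let P : Finset (Fin d → ℤ) → Prop := fun H => ∃ l, SupportsOn A H l ∧ l y < 0
  have hP : (A.powerset.filter P).Nonempty := by
    obtain ⟨f, u, hu, huy⟩ := geometric_hahn_banach_closed_point convex_latticePolytope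
      isCompact_latticePolytope.isClosed hyA
    obtain ⟨a₀, ha₀, hmax⟩ := A.exists_max_image (fun a => f (latticePt a)) hne
    let l : (Fin d → ℝ) →ᵃ[ℝ] ℝ :=
      AffineMap.const ℝ _ (f (latticePt a₀)) - (f : (Fin d → ℝ) →ₗ[ℝ] ℝ).toAffineMap
    have hl : ∀ x, l x = f (latticePt a₀) - f x := fun x => by simp [l]
    refine ⟨A.filter fun a => l (latticePt a) = 0, Finset.mem_filter.2
      ⟨Finset.mem_powerset.2 (Finset.filter_subset _ _), l, ⟨Finset.filter_subset _ _,
        ⟨a₀, Finset.mem_filter.2 ⟨ha₀, by simp [hl]⟩⟩, fun a ha => ?_, fun a ha => ?_⟩, ?_⟩⟩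
    · rw [hl]; linarith [hmax a ha]
    · rw [Finset.mem_filter, and_iff_right ha]
    · rw [hl]; linarith [hu _ (latticePt_mem_latticePolytope ha₀)]
  obtain ⟨H, hH, hmax⟩ := (A.powerset.filter P).exists_max_image Finset.card hP
  obtain ⟨-, l, hl, hly⟩ := Finset.mem_filter.1 hH
  have hHA : latticeSet H ⊆ latticeSet A := Set.image_mono (by exact_mod_cast hl.subset)
  have hHne : (latticeSet H).Nonempty := by
    obtain ⟨g, hg⟩ := hl.nonempty
    exact ⟨_, g, hg, rfl⟩
  have hlH : ∀ x ∈ latticeSet H, l x = 0 := by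
    rintro _ ⟨a, ha, rfl⟩
    exact (hl.eq_zero_iff a (hl.subset ha)).2 ha
  have hnotMem : ∀ x, l x ≠ 0 → x ∉ affineSpan ℝ (latticeSet H) := fun x hx hmem =>
    hx (l.eq_zero_of_mem_affineSpan hlH hmem)
  have hdim : Module.finrank ℝ (vectorSpan ℝ (latticeSet A)) ≤
      Module.finrank ℝ (vectorSpan ℝ (latticeSet H)) + 1 := by
    -- Otherwise some form vanishes on `H` and at `y` but is negative at a point of `A`. Rotating
    -- about `H` with it leaves the value at `y` unchanged and enlarges `H`, against maximality.
    have hspan : latticeSet A ⊆ affineSpan ℝ (insert y (latticeSet H)) := by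
      rintro _ ⟨b, hb, rfl⟩
      by_contra hbn
      obtain ⟨q, hq⟩ := hHne
      obtain ⟨m, hm0, hmb⟩ := AffineSubspace.exists_affineMap_eq_zero_ne_zero
        (mem_affineSpan ℝ (Set.mem_insert_of_mem y hq)) hbn
      obtain ⟨m', hm'0, hm'b⟩ : ∃ m' : (Fin d → ℝ) →ᵃ[ℝ] ℝ,
          (∀ x ∈ affineSpan ℝ (insert y (latticeSet H)), m' x = 0) ∧ m' (latticePt b) < 0 := by
        rcases lt_or_gt_of_ne hmb with h | h
        · exact ⟨m, hm0, h⟩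
        · exact ⟨-m, fun x hx => by simp [hm0 x hx], by simpa using h⟩
      obtain ⟨H', s, hH', hcard⟩ := hl.exists_larger (m := m')
        (fun a ha => hm'0 _ (mem_affineSpan ℝ (Set.mem_insert_of_mem y ⟨a, ha, rfl⟩)))
        ⟨b, hb, hm'b⟩
      refine absurd (hmax H' (Finset.mem_filter.2 ⟨Finset.mem_powerset.2 hH'.subset, _, hH', ?_⟩))
        (not_le.2 hcard)
      have := hm'0 y (mem_affineSpan ℝ (Set.mem_insert y _))
      simpa [this] using hly
    have h1 : vectorSpan ℝ (latticeSet A) ≤ vectorSpan ℝ (insert y (latticeSet H)) := by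
      rw [← direction_affineSpan, ← direction_affineSpan]
      exact AffineSubspace.direction_le (affineSpan_le.2 hspan)
    exact (Submodule.finrank_mono h1).trans (finrank_vectorSpan_insert_le_set ℝ _ _)
  obtain ⟨a, ha, hla⟩ : ∃ a ∈ A, l (latticePt a) ≠ 0 := by
    by_contra! hc
    refine hly.ne (l.eq_zero_of_mem_affineSpan ?_ hy)
    rintro _ ⟨a, ha, rfl⟩
    exact hc a ha
  have hspan := affineSpan_insert_eq_of_finrank hHA hHne
    (mem_affineSpan ℝ ⟨a, ha, rfl⟩) (hnotMem _ hla) hdim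
  have hfacet : IsFacet A H := by
    refine ⟨hl.subset, hl.nonempty, ⟨l, hl.nonneg, hl.eq_zero_iff⟩, le_antisymm ?_ hdim⟩
    have hlt : affineSpan ℝ (latticeSet H) < affineSpan ℝ (latticeSet A) :=
      lt_of_le_of_ne (affineSpan_mono ℝ hHA) fun h =>
        hnotMem _ hla (h ▸ mem_affineSpan ℝ ⟨a, ha, rfl⟩)
    exact finrank_vectorSpan_lt_of_affineSpan_lt hHne hlt
  have hspec := facetForm_spec hfacet
  set k := facetForm A H
  -- Both forms vanish on `H`, so they are proportional on the affine span of `A`, with positive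
  -- factor. Thus the facet form is negative at `y` too.
  have hm : (l (latticePt a) • k - k (latticePt a) • l) y = 0 := by
    refine AffineMap.eq_zero_of_mem_affineSpan (s := insert (latticePt a) (latticeSet H)) _ ?_
      (hspan ▸ hy)
    rintro x (rfl | hx)
    · simp [mul_comm]
    · have h2 : k x = 0 := by
        obtain ⟨g, hg, rfl⟩ := hx
        exact (hspec.eq_zero_iff g (hl.subset hg)).2 hg
      simp [h2, hlH x hx]
  have hka : 0 < k (latticePt a) :=
    lt_of_le_of_ne (hspec.nonneg _ (latticePt_mem_latticePolytope ha)) fun h0 =>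
      hla ((hl.eq_zero_iff a ha).2 ((hspec.eq_zero_iff a ha).1 h0.symm))
  have hla' : 0 < l (latticePt a) := lt_of_le_of_ne (hl.nonneg a ha) hla.symm
  have hm' : l (latticePt a) * k y - k (latticePt a) * l y = 0 := by simpa using hm
  have := mul_nonneg hla'.le (h H hfacet)
  have := mul_neg_of_pos_of_neg hka hly
  linarith

open Classical in
/-- The finite set of facets of `Δ_A`. -/
noncomputable def facets (A : Finset (Fin d → ℤ)) : Finset (Finset (Fin d → ℤ)) :=
  A.powerset.filter fun G => IsFacet A G

theorem mem_facets {G : Finset (Fin d → ℤ)} : G ∈ facets A ↔ IsFacet A G := by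
  classical
  rw [facets, Finset.mem_filter, Finset.mem_powerset, and_iff_right_iff_imp]
  exact fun h => h.subset

theorem facetForm_nonneg {G : Finset (Fin d → ℤ)} (hG : G ∈ facets A) {x : Fin d → ℝ}
    (hx : x ∈ latticePolytope A) : 0 ≤ facetForm A G x :=
  (facetForm_spec (mem_facets.1 hG)).nonneg x hx

theorem facetForm_latticePt_nonneg {G : Finset (Fin d → ℤ)} (hG : G ∈ facets A) {a : Fin d → ℤ}
    (ha : a ∈ A) : 0 ≤ facetForm A G (latticePt a) :=
  facetForm_nonneg hG (latticePt_mem_latticePolytope ha)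

/-- Facets are treated one at a time: the midpoint with a point of `A` off the new facet makes the
new form positive and keeps the earlier ones positive. -/
theorem exists_forall_facetForm_pos (hA : A.Nonempty) :
    ∃ x ∈ latticePolytope A, ∀ G ∈ facets A, 0 < facetForm A G x := by
  suffices H : ∀ S ⊆ facets A, ∃ x ∈ latticePolytope A, ∀ G ∈ S, 0 < facetForm A G x from
    H _ subset_rfl
  intro S
  induction S using Finset.induction_on with
  | empty =>
    obtain ⟨a, ha⟩ := hA
    exact fun _ => ⟨_, latticePt_mem_latticePolytope ha, by simp⟩
  | insert G S _ ih =>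
    intro hS
    obtain ⟨hG, hS⟩ := Finset.insert_subset_iff.1 hS
    obtain ⟨x, hx, hxS⟩ := ih hS
    obtain ⟨a, ha, haG⟩ := (mem_facets.1 hG).exists_notMem
    have hpos : 0 < facetForm A G (latticePt a) :=
      lt_of_le_of_ne (facetForm_latticePt_nonneg hG ha) fun h =>
        haG (((facetForm_spec (mem_facets.1 hG)).eq_zero_iff a ha).1 h.symm)
    refine ⟨AffineMap.lineMap x (latticePt a) (1 / 2 : ℝ),
      convex_latticePolytope.lineMap_mem hx (latticePt_mem_latticePolytope ha)
        (by norm_num), fun K hK => ?_⟩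
    rw [AffineMap.apply_lineMap, AffineMap.lineMap_apply_ring']
    rcases Finset.mem_insert.1 hK with rfl | hK
    · linarith [facetForm_nonneg hG hx]
    · linarith [hxS K hK, facetForm_latticePt_nonneg (hS hK) ha]

/-- From a point where all facet forms are positive one can move a little along any line inside
the affine span without leaving the polytope. -/
theorem eventually_lineMap_mem_latticePolytope {x a : Fin d → ℝ} (hx : x ∈ latticePolytope A)
    (ha : a ∈ latticePolytope A) (hpos : ∀ G ∈ facets A, 0 < facetForm A G x) :
    ∀ᶠ s in 𝓝 (0 : ℝ), AffineMap.lineMap x a s ∈ latticePolytope A := by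
  have key : ∀ G ∈ facets A, ∀ᶠ s in 𝓝 (0 : ℝ), 0 < facetForm A G (AffineMap.lineMap x a s) := by
    intro G hG
    have hc : Continuous fun s : ℝ => facetForm A G (AffineMap.lineMap x a s) :=
      (AffineMap.continuous_of_finiteDimensional _).comp AffineMap.lineMap_continuous
    refine hc.continuousAt.eventually_const_lt ?_
    simpa using hpos G hG
  filter_upwards [(Filter.eventually_all_finset _).2 key] with s hs
  refine mem_latticePolytope_of_facetForm_nonneg ?_ fun G hG => (hs G (mem_facets.2 hG)).le
  exact AffineMap.lineMap_mem _ (convexHull_subset_affineSpan _ hx)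
    (convexHull_subset_affineSpan _ ha)

end Polytope

/-! ### Solving for the parameter point by entropy minimization -/

section Entropy

variable {d : ℕ} {A : Finset (Fin d → ℤ)}

/-- Every affine form `φ` on `A` is, up to a constant, the logarithmic derivative
`∑_G log h_G(x) · h_G` of the entropy at some point `x` of the polytope where all `h_G` are
positive: `x` minimizes `∑_G (h_G log h_G - h_G) - φ`. -/
theorem exists_sum_log_facetForm_eq (hA : A.Nonempty) (φ : (Fin d → ℝ) →ᵃ[ℝ] ℝ) :
    ∃ x ∈ latticePolytope A, (∀ G ∈ facets A, 0 < facetForm A G x) ∧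
      ∃ c, ∀ a ∈ A, ∑ G ∈ facets A, Real.log (facetForm A G x) * facetForm A G (latticePt a) =
        φ (latticePt a) + c := by
  classical
  -- The added sum of facet forms cancels the `1` in the derivative `log r + 1` of `r * log r`.
  let ψ : (Fin d → ℝ) →ᵃ[ℝ] ℝ := φ + ∑ G ∈ facets A, facetForm A G
  have hψ : ∀ y, ψ y = φ y + ∑ G ∈ facets A, facetForm A G y := by
    intro y
    rw [← AffineMap.finsetSum_apply]
    rfl
  let Φ : (Fin d → ℝ) → ℝ := fun y =>
    ∑ G ∈ facets A, facetForm A G y * Real.log (facetForm A G y) - ψ y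
  have hΦc : Continuous Φ := by
    refine Continuous.sub (continuous_finsetSum _ fun G _ => ?_)
      (AffineMap.continuous_of_finiteDimensional _)
    exact Real.continuous_mul_log.comp (AffineMap.continuous_of_finiteDimensional _)
  obtain ⟨x₀, hx₀, hx₀pos⟩ := exists_forall_facetForm_pos hA
  obtain ⟨x, hx, hmin⟩ := isCompact_latticePolytope.exists_isMinOn ⟨x₀, hx₀⟩ hΦc.continuousOn
  have hmin' : ∀ y ∈ latticePolytope A, Φ x ≤ Φ y := fun y hy => hmin hy
  -- The slope of `r * log r` at `0` is `-∞`, so a minimizer cannot lie on a facet. Moving from `x`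
  -- by `s` towards `x₀` gains `s * k * log s` beyond convexity. The choice of `s` makes this `-s *
  -- (C + 1)`, whence `Φ y ≤ Φ x - s`.
  have hpos : ∀ G ∈ facets A, 0 < facetForm A G x := by
    intro K hK
    by_contra hK0
    have hKx : facetForm A K x = 0 := le_antisymm (not_lt.1 hK0) (facetForm_nonneg hK hx)
    set k := facetForm A K x₀ with hk
    have hkpos : 0 < k := hx₀pos K hK
    set C := Φ x₀ - Φ x with hC
    have hC0 : 0 ≤ C := sub_nonneg.2 (hmin' _ hx₀)
    set s : ℝ := Real.exp (-((C + 1) / k)) with hs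
    have hs0 : 0 < s := Real.exp_pos _
    have hs1 : s ≤ 1 := Real.exp_le_one_iff.2 (by
      have : 0 ≤ (C + 1) / k := by positivity
      linarith)
    have hlogs : k * Real.log s = -(C + 1) := by
      rw [hs, Real.log_exp]; field_simp
    set y := AffineMap.lineMap x x₀ s with hy
    have hyA : y ∈ latticePolytope A :=
      convex_latticePolytope.lineMap_mem hx hx₀ ⟨hs0.le, hs1⟩
    have hval : ∀ m : (Fin d → ℝ) →ᵃ[ℝ] ℝ, m y = (1 - s) * m x + s * m x₀ := by
      intro m
      rw [hy, AffineMap.apply_lineMap, AffineMap.lineMap_apply_ring]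
    let ent : ℝ → ℝ := fun r => r * Real.log r
    have hterm : ∀ G ∈ facets A, ent (facetForm A G y) ≤
        (1 - s) * ent (facetForm A G x) + s * ent (facetForm A G x₀) +
          if G = K then s * (k * Real.log s) else 0 := by
      intro G hG
      split_ifs with hGK
      · subst hGK
        rw [hval, hKx, ← hk]
        simp only [ent, mul_zero, zero_add, zero_mul]
        rw [Real.log_mul hs0.ne' hkpos.ne']
        apply le_of_eq; ring
      · have := Real.convexOn_mul_log.2 (Set.mem_Ici.2 (facetForm_nonneg hG hx))
          (Set.mem_Ici.2 (facetForm_nonneg hG hx₀)) (sub_nonneg.2 hs1) hs0.le (by ring)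
        simp only [smul_eq_mul] at this
        rw [hval, add_zero]
        exact this
    have hsum := Finset.sum_le_sum hterm
    rw [Finset.sum_add_distrib, Finset.sum_add_distrib, ← Finset.mul_sum, ← Finset.mul_sum,
      Finset.sum_ite_eq' , if_pos hK, hlogs] at hsum
    have h1 : Φ y ≤ (1 - s) * Φ x + s * Φ x₀ + s * -(C + 1) := by
      simp only [Φ, hval ψ]
      simp only [ent] at hsum
      linarith
    have h2 := hmin' y hyA
    have h3 : (1 - s) * Φ x + s * Φ x₀ + s * -(C + 1) = Φ x - s := by rw [hC]; ring
    linarith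
  refine ⟨x, hx, hpos,
    ∑ G ∈ facets A, Real.log (facetForm A G x) * facetForm A G x - φ x, fun a ha => ?_⟩
  have haA := latticePt_mem_latticePolytope ha
  -- All facet forms are positive at `x`, so the line may be followed in both directions and the
  -- derivative at the minimum is zero.
  have hloc : IsLocalMin (fun s : ℝ => Φ (AffineMap.lineMap x (latticePt a) s)) 0 := by
    filter_upwards [eventually_lineMap_mem_latticePolytope hx haA hpos] with s hs
    simpa using hmin' _ hs
  have hline : ∀ m : (Fin d → ℝ) →ᵃ[ℝ] ℝ, HasDerivAt
      (fun s : ℝ => m (AffineMap.lineMap x (latticePt a) s)) (m (latticePt a) - m x) 0 := by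
    intro m
    have : (fun s : ℝ => m (AffineMap.lineMap x (latticePt a) s)) =
        fun s => s * (m (latticePt a) - m x) + m x := by
      ext s; rw [AffineMap.apply_lineMap, AffineMap.lineMap_apply_ring']
    rw [this]
    simpa using ((hasDerivAt_id (0 : ℝ)).mul_const (m (latticePt a) - m x)).add_const (m x)
  have hder : HasDerivAt (fun s : ℝ => Φ (AffineMap.lineMap x (latticePt a) s))
      (∑ G ∈ facets A, (Real.log (facetForm A G x) + 1) *
        (facetForm A G (latticePt a) - facetForm A G x) - (ψ (latticePt a) - ψ x)) 0 := by
    refine HasDerivAt.sub (HasDerivAt.fun_sum fun G hG => ?_) (hline ψ)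
    refine HasDerivAt.comp (h₂ := fun r => r * Real.log r) (0 : ℝ) ?_ (hline _)
    simpa using Real.hasDerivAt_mul_log (hpos G hG).ne'
  have h0 := hloc.hasDerivAt_eq_zero hder
  simp only [hψ, add_mul, mul_sub, Finset.sum_add_distrib, Finset.sum_sub_distrib, one_mul] at h0
  linarith

end Entropy

/-! ### Patches as closures of torus orbits -/

section Gibbs

variable {d : ℕ} {A : Finset (Fin d → ℤ)} {w : (Fin d → ℤ) → ℝ}
  {E : Type*} [NormedAddCommGroup E] [NormedSpace ℝ E]

/-- The weighted average of the points `b a`, `a ∈ A`, with Gibbs weights `w a * exp (g a)`. -/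
noncomputable def gibbsPoint {ι E : Type*} [AddCommGroup E] [Module ℝ E] (A : Finset ι)
    (w g : ι → ℝ) (b : ι → E) : E :=
  (∑ a ∈ A, w a * Real.exp (g a))⁻¹ • ∑ a ∈ A, (w a * Real.exp (g a)) • b a

/-- The orbit of the positive torus whose closure is the patch `toricPatch A w b`. -/
def torusOrbit {d : ℕ} {E : Type*} [AddCommGroup E] [Module ℝ E] (A : Finset (Fin d → ℤ))
    (w : (Fin d → ℤ) → ℝ) (b : (Fin d → ℤ) → E) : Set E :=
  Set.range fun φ : (Fin d → ℝ) →ᵃ[ℝ] ℝ => gibbsPoint A w (fun a => φ (latticePt a)) b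

theorem sum_gibbsWeight_pos {ι : Type*} {A : Finset ι} {w : ι → ℝ} (hA : A.Nonempty)
    (hw : ∀ a ∈ A, 0 < w a) (g : ι → ℝ) : 0 < ∑ a ∈ A, w a * Real.exp (g a) :=
  Finset.sum_pos (fun a ha => mul_pos (hw a ha) (Real.exp_pos _)) hA

/-- Gibbs points do not change when the weights are multiplied by a common positive factor. -/
theorem gibbsPoint_eq_of_mul {ι E : Type*} [AddCommGroup E] [Module ℝ E] {A : Finset ι}
    {w g v : ι → ℝ} {b : ι → E} {r : ℝ} (hr : r ≠ 0)
    (h : ∀ a ∈ A, v a = r * (w a * Real.exp (g a))) :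
    gibbsPoint A w g b = (∑ a ∈ A, v a)⁻¹ • ∑ a ∈ A, v a • b a := by
  have h1 : ∑ a ∈ A, v a = r * ∑ a ∈ A, w a * Real.exp (g a) := by
    rw [Finset.mul_sum]
    exact Finset.sum_congr rfl h
  have h2 : ∑ a ∈ A, v a • b a = r • ∑ a ∈ A, (w a * Real.exp (g a)) • b a := by
    rw [Finset.smul_sum]
    refine Finset.sum_congr rfl fun a ha => ?_
    rw [h a ha, mul_smul]
  rw [h1, h2, gibbsPoint, smul_smul, mul_inv, mul_comm r⁻¹, mul_assoc, inv_mul_cancel₀ hr, mul_one]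

theorem gibbsPoint_mem_convexHull (hA : A.Nonempty) (hw : ∀ a ∈ A, 0 < w a)
    (g : (Fin d → ℤ) → ℝ) (b : (Fin d → ℤ) → E) {s : Set (Fin d → ℤ)} (hs : ∀ a ∈ A, a ∈ s) :
    gibbsPoint A w g b ∈ convexHull ℝ (b '' s) :=
  Finset.centerMass_mem_convexHull A (fun a ha => (mul_pos (hw a ha) (Real.exp_pos _)).le)
    (sum_gibbsWeight_pos hA hw g) fun a ha => ⟨a, hs a ha, rfl⟩

theorem toricBasis_eq_prod_facets (a : Fin d → ℤ) (x : Fin d → ℝ) :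
    toricBasis A a x = ∏ G ∈ facets A, facetForm A G x ^ facetForm A G (latticePt a) := rfl

theorem toricBasis_eq_exp {x : Fin d → ℝ} (hx : ∀ G ∈ facets A, 0 < facetForm A G x)
    (a : Fin d → ℤ) : toricBasis A a x =
      Real.exp (∑ G ∈ facets A, Real.log (facetForm A G x) * facetForm A G (latticePt a)) := by
  rw [toricBasis_eq_prod_facets, Real.exp_sum]
  exact Finset.prod_congr rfl fun G hG => Real.rpow_def_of_pos (hx G hG) _

/-- The entropy minimizer for `φ` is the parameter point; the constant `c` is a common factor `exp
c` of the weights and cancels. -/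
theorem torusOrbit_subset_toricPatch (hA : A.Nonempty) (b : (Fin d → ℤ) → E) :
    torusOrbit A w b ⊆ toricPatch A w b := by
  rintro _ ⟨φ, rfl⟩
  obtain ⟨x, hx, hpos, c, hc⟩ := exists_sum_log_facetForm_eq hA φ
  refine ⟨x, hx, (gibbsPoint_eq_of_mul (Real.exp_ne_zero c) fun a ha => ?_).symm⟩
  rw [toricBasis_eq_exp hpos, hc a ha, Real.exp_add]
  ring

theorem toricMap_mem_torusOrbit {x : Fin d → ℝ} (hx : ∀ G ∈ facets A, 0 < facetForm A G x)
    (b : (Fin d → ℤ) → E) : toricMap A w b x ∈ torusOrbit A w b := by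
  refine ⟨∑ G ∈ facets A, Real.log (facetForm A G x) • facetForm A G, ?_⟩
  refine gibbsPoint_eq_of_mul one_ne_zero fun a ha => ?_
  rw [toricBasis_eq_exp hx, AffineMap.finsetSum_apply, one_mul]
  rfl

theorem toricBasis_nonneg (a : Fin d → ℤ) {x : Fin d → ℝ} (hx : x ∈ latticePolytope A) :
    0 ≤ toricBasis A a x :=
  Finset.prod_nonneg fun _ hG => Real.rpow_nonneg (facetForm_nonneg hG hx) _

/-- This keeps the denominator of `toricMap` nonzero on the boundary. The sum of the facet forms
vanishing at `x` is at most `0` at some `a ∈ A`, so all of them vanish at `a`, and their factors are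
`0 ^ 0 = 1`. -/
theorem exists_toricBasis_pos {x : Fin d → ℝ} (hx : x ∈ latticePolytope A) :
    ∃ a ∈ A, 0 < toricBasis A a x := by
  classical
  let S := (facets A).filter fun G => facetForm A G x = 0
  obtain ⟨a, ha, hle⟩ := exists_apply_le_of_mem_latticePolytope (∑ G ∈ S, facetForm A G) hx
  rw [AffineMap.finsetSum_apply, AffineMap.finsetSum_apply, Finset.sum_eq_zero (s := S) fun G hG => (Finset.mem_filter.1 hG).2] at hle
  have hnn : ∀ G ∈ S, 0 ≤ facetForm A G (latticePt a) := fun G hG =>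
    facetForm_latticePt_nonneg (Finset.mem_filter.1 hG).1 ha
  have hzero := (Finset.sum_eq_zero_iff_of_nonneg hnn).1 (le_antisymm hle (Finset.sum_nonneg hnn))
  refine ⟨a, ha, Finset.prod_pos fun G hG => ?_⟩
  change G ∈ facets A at hG
  rcases (facetForm_nonneg hG hx).eq_or_lt with h | h
  · rw [hzero G (Finset.mem_filter.2 ⟨hG, h.symm⟩), Real.rpow_zero]
    exact one_pos
  · exact Real.rpow_pos_of_pos h _

theorem continuous_toricBasis {a : Fin d → ℤ} (ha : a ∈ A) :
    Continuous fun x => toricBasis A a x := by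
  simp only [toricBasis_eq_prod_facets]
  exact continuous_finsetProd _ fun G hG =>
    (AffineMap.continuous_of_finiteDimensional _).rpow_const
      fun _ => Or.inr (facetForm_latticePt_nonneg hG ha)

theorem continuousAt_toricMap (hw : ∀ a ∈ A, 0 < w a) (b : (Fin d → ℤ) → E) {x : Fin d → ℝ}
    (hx : x ∈ latticePolytope A) : ContinuousAt (toricMap A w b) x := by
  have hpos : 0 < ∑ a ∈ A, w a * toricBasis A a x := by
    obtain ⟨a, ha, h⟩ := exists_toricBasis_pos hx
    exact Finset.sum_pos' (fun c hc => mul_nonneg (hw c hc).le (toricBasis_nonneg c hx))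
      ⟨a, ha, mul_pos (hw a ha) h⟩
  refine ContinuousAt.smul (ContinuousAt.inv₀ ?_ hpos.ne') ?_
  · exact (continuous_finsetSum _ fun a ha =>
      continuous_const.mul (continuous_toricBasis ha)).continuousAt
  · exact (continuous_finsetSum _ fun a ha =>
      (continuous_const.mul (continuous_toricBasis ha)).smul continuous_const).continuousAt

theorem toricPatch_subset_closure_torusOrbit (hw : ∀ a ∈ A, 0 < w a) (b : (Fin d → ℤ) → E) :
    toricPatch A w b ⊆ closure (torusOrbit A w b) := by
  rintro _ ⟨x, hx, rfl⟩
  obtain ⟨a, ha, -⟩ := exists_apply_le_of_mem_latticePolytope (AffineMap.const ℝ _ (0 : ℝ)) hx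
  obtain ⟨x₀, hx₀, hx₀pos⟩ := exists_forall_facetForm_pos ⟨a, ha⟩
  -- `U` need not lie in the polytope: positivity of the facet forms alone puts the image in the
  -- orbit.
  let U : Set (Fin d → ℝ) := {y | ∀ G ∈ facets A, 0 < facetForm A G y}
  have hU : x ∈ closure U := by
    have hsub : openSegment ℝ x x₀ ⊆ U := by
      rw [openSegment_eq_image_lineMap]
      rintro _ ⟨s, ⟨hs0, hs1⟩, rfl⟩ G hG
      rw [AffineMap.apply_lineMap, AffineMap.lineMap_apply_ring]
      have := mul_nonneg (sub_nonneg.2 hs1.le) (facetForm_nonneg hG hx)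
      have := mul_pos hs0 (hx₀pos G hG)
      linarith
    refine closure_mono hsub ?_
    rw [closure_openSegment]
    exact left_mem_segment ℝ x x₀
  refine closure_mono ?_
    ((continuousAt_toricMap hw b hx).continuousWithinAt.mem_closure_image hU)
  rintro _ ⟨y, hy, rfl⟩
  exact toricMap_mem_torusOrbit hy b

end Gibbs

/-! ### Faces of the regular decomposition as sets of maximizers -/

section RegularDecomposition

variable {d : ℕ} {A F : Finset (Fin d → ℤ)} {lam : (Fin d → ℤ) → ℝ}

theorem le_of_mem_liftedPolytope {v : Fin d → ℝ} {s c : ℝ}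
    (h : ∀ a ∈ A, v ⬝ᵥ latticePt a + s * lam a ≤ c) {q : (Fin d → ℝ) × ℝ}
    (hq : q ∈ liftedPolytope A lam) : v ⬝ᵥ q.1 + s * q.2 ≤ c := by
  have hconv : Convex ℝ {q : (Fin d → ℝ) × ℝ | v ⬝ᵥ q.1 + s * q.2 ≤ c} := by
    refine convex_halfSpace_le ⟨fun p q => ?_, fun r p => ?_⟩ c
    · simp [dotProduct_add, mul_add]; ring
    · simp [dotProduct_smul]; ring
  refine convexHull_min ?_ hconv hq
  rintro _ ⟨a, ha, rfl⟩
  exact h a ha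

/-- The faces of the regular decomposition are the sets where a function `χ + s * lam`, with `χ`
affine and `s > 0`, attains its maximum on `A`. -/
theorem mem_regularDecomposition_iff : F ∈ regularDecomposition A lam ↔
    F ⊆ A ∧ F.Nonempty ∧ ∃ (χ : (Fin d → ℝ) →ᵃ[ℝ] ℝ) (s : ℝ), 0 < s ∧
      ∀ a ∈ A, χ (latticePt a) + s * lam a ≤ 0 ∧
        (χ (latticePt a) + s * lam a = 0 ↔ a ∈ F) := by
  constructor
  · rintro ⟨Q, ⟨⟨q, hq⟩, v, s, hs, rfl⟩, hF⟩
    obtain ⟨hqP, hqmax⟩ := hq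
    set c := v ⬝ᵥ q.1 + s * q.2 with hc
    have hle : ∀ a ∈ A, v ⬝ᵥ latticePt a + s * lam a ≤ c := fun a ha =>
      hqmax (liftPt lam a) (subset_convexHull ℝ _ ⟨a, ha, rfl⟩)
    have hmem : ∀ a ∈ A, (v ⬝ᵥ latticePt a + s * lam a = c ↔ a ∈ F) := by
      intro a ha
      have haP : liftPt lam a ∈ liftedPolytope A lam := subset_convexHull ℝ _ ⟨a, ha, rfl⟩
      rw [hF, and_iff_right ha]
      constructor
      · intro h
        refine ⟨haP, fun p hp => ?_⟩
        have := hqmax p hp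
        rw [← h] at this
        exact this
      · rintro ⟨-, h⟩
        exact le_antisymm (hle a ha) (h q hqP)
    refine ⟨fun a ha => ((hF a).1 ha).1, ?_, ?_⟩
    -- A linear functional on the lifted polytope attains its maximum at some lifted point of `A`.
    · by_contra hne
      rw [Finset.not_nonempty_iff_eq_empty] at hne
      subst hne
      have hA : A.Nonempty := by
        rcases A.eq_empty_or_nonempty with rfl | h
        · simp [liftedPolytope] at hqP
        · exact h
      obtain ⟨a₀, ha₀, hmax⟩ := A.exists_max_image
        (fun a => v ⬝ᵥ latticePt a + s * lam a) hA
      have h1 := le_of_mem_liftedPolytope (lam := lam) hmax hqP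
      have h2 := (hmem a₀ ha₀).1 (le_antisymm (hle a₀ ha₀) h1)
      simp at h2
    · let f : (Fin d → ℝ) →ₗ[ℝ] ℝ := ∑ i, v i • LinearMap.proj i
      have hf : ∀ x, f x = v ⬝ᵥ x := fun x => by simp [f, dotProduct]
      refine ⟨f.toAffineMap - AffineMap.const ℝ _ c, s, hs, fun a ha => ?_⟩
      have hval : (f.toAffineMap - AffineMap.const ℝ (Fin d → ℝ) c) (latticePt a) + s * lam a =
          v ⬝ᵥ latticePt a + s * lam a - c := by
        simp [hf]; ring
      rw [hval, sub_nonpos, sub_eq_zero]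
      exact ⟨hle a ha, hmem a ha⟩
  · rintro ⟨hFA, ⟨a₀, ha₀⟩, χ, s, hs, h⟩
    let v : Fin d → ℝ := fun i => χ.linear (fun j => if i = j then 1 else 0)
    have hv : ∀ x, v ⬝ᵥ x = χ x - χ 0 := by
      intro x
      have h1 := LinearMap.pi_apply_eq_sum_univ χ.linear x
      have h2 : χ.linear x = χ x - χ 0 := by
        simpa using χ.linearMap_vsub x 0
      rw [← h2, h1]
      exact Finset.sum_congr rfl fun i _ => mul_comm _ _
    have hle : ∀ a ∈ A, v ⬝ᵥ latticePt a + s * lam a ≤ -χ 0 := fun a ha => by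
      rw [hv]; linarith [(h a ha).1]
    have heq : ∀ a ∈ F, v ⬝ᵥ latticePt a + s * lam a = -χ 0 := fun a ha => by
      rw [hv]; linarith [(h a (hFA ha)).2.2 ha]
    have hmem : ∀ a, a ∈ F ↔ a ∈ A ∧ liftPt lam a ∈ {p | p ∈ liftedPolytope A lam ∧
        ∀ q ∈ liftedPolytope A lam, v ⬝ᵥ q.1 + s * q.2 ≤ v ⬝ᵥ p.1 + s * p.2} := by
      refine fun a => ⟨fun ha => ⟨hFA ha, subset_convexHull ℝ _ ⟨a, hFA ha, rfl⟩,
        fun q hq => ?_⟩, fun ⟨ha, _, hmax⟩ => ?_⟩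
      · exact (le_of_mem_liftedPolytope hle hq).trans_eq (heq a ha).symm
      · have h1 : v ⬝ᵥ latticePt a₀ + s * lam a₀ ≤ v ⬝ᵥ latticePt a + s * lam a :=
          hmax (liftPt lam a₀) (subset_convexHull ℝ _ ⟨a₀, hFA ha₀, rfl⟩)
        rw [heq a₀ ha₀, hv] at h1
        exact (h a ha).2.1 (le_antisymm (h a ha).1 (by linarith))
    exact ⟨_, ⟨⟨_, ((hmem a₀).1 ha₀).2⟩, v, s, hs, rfl⟩, hmem⟩

end RegularDecomposition

/-! ### Limits of orbits and of patches -/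

section Degeneration

variable {d : ℕ} {A F : Finset (Fin d → ℤ)} {w lam : (Fin d → ℤ) → ℝ}
  {E : Type*} [NormedAddCommGroup E] [NormedSpace ℝ E]

/-- Weights with `f a < 0` decay exponentially, the others do not change, and the total keeps a
positive limit because `F` is nonempty. -/
theorem tendsto_gibbsPoint {ι : Type*} {A F : Finset ι} {w : ι → ℝ} (hw : ∀ a ∈ A, 0 < w a)
    (hFA : F ⊆ A) (hF : F.Nonempty) {f : ι → ℝ}
    (hf : ∀ a ∈ A, f a ≤ 0 ∧ (f a = 0 ↔ a ∈ F)) (g : ι → ℝ) (b : ι → E) :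
    Tendsto (fun s : ℝ => gibbsPoint A w (fun a => g a + s * f a) b) atTop
      (𝓝 (gibbsPoint F w g b)) := by
  classical
  have hterm : ∀ a ∈ A, Tendsto (fun s : ℝ => w a * Real.exp (g a + s * f a)) atTop
      (𝓝 (if a ∈ F then w a * Real.exp (g a) else 0)) := by
    intro a ha
    split_ifs with haF
    · simp [(hf a ha).2.2 haF]
    · have hneg : f a < 0 := lt_of_le_of_ne (hf a ha).1 fun h => haF ((hf a ha).2.1 h)
      have := (Real.tendsto_exp_comp_nhds_zero.2 (tendsto_atBot_add_const_left atTop (g a)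
        (tendsto_id.atTop_mul_const_of_neg hneg))).const_mul (w a)
      simpa using this
  have hsum : ∀ u : ι → ℝ, ∑ a ∈ A, (if a ∈ F then u a else 0) = ∑ a ∈ F, u a := by
    intro u
    rw [← Finset.sum_filter, Finset.filter_mem_eq_inter, Finset.inter_eq_right.2 hFA]
  have hsumE : ∑ a ∈ A, (if a ∈ F then w a * Real.exp (g a) else 0) • b a =
      ∑ a ∈ F, (w a * Real.exp (g a)) • b a := by
    simp only [ite_smul, zero_smul]
    rw [← Finset.sum_filter, Finset.filter_mem_eq_inter, Finset.inter_eq_right.2 hFA]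
  have h1 := tendsto_finsetSum A hterm
  have h2 := tendsto_finsetSum A fun a ha => (hterm a ha).smul_const (b a)
  rw [hsum] at h1
  rw [hsumE] at h2
  exact (h1.inv₀ (sum_gibbsWeight_pos hF (fun a ha => hw a (hFA ha)) g).ne').smul h2

theorem degenerationWeights_pos (hw : ∀ a ∈ A, 0 < w a) {t : ℝ} (ht : 0 < t) :
    ∀ a ∈ A, 0 < degenerationWeights w lam t a :=
  fun a ha => mul_pos (Real.rpow_pos_of_pos ht _) (hw a ha)

theorem degenerationWeights_mul_exp {t : ℝ} (ht : 0 < t) (a : Fin d → ℤ) (r : ℝ) :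
    degenerationWeights w lam t a * Real.exp r = w a * Real.exp (r + Real.log t * lam a) := by
  rw [degenerationWeights, Real.rpow_def_of_pos ht, Real.exp_add]
  ring

theorem gibbsPoint_degenerationWeights {t : ℝ} (ht : 0 < t) (g : (Fin d → ℤ) → ℝ)
    (b : (Fin d → ℤ) → E) : gibbsPoint A (degenerationWeights w lam t) g b =
      gibbsPoint A w (fun a => g a + Real.log t * lam a) b := by
  simp only [gibbsPoint, degenerationWeights_mul_exp ht]

/-- Every point of the orbit of a face of the regular decomposition is a limit of points of the
degenerating orbits. -/
theorem eventually_exists_torusOrbit_dist_lt (hw : ∀ a ∈ A, 0 < w a) (b : (Fin d → ℤ) → E)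
    (hF : F ∈ regularDecomposition A lam) {y : E} (hy : y ∈ torusOrbit F w b) {ε : ℝ}
    (hε : 0 < ε) : ∀ᶠ t in atTop,
      ∃ x ∈ torusOrbit A (degenerationWeights w lam t) b, dist y x < ε := by
  obtain ⟨ψ, rfl⟩ := hy
  obtain ⟨hFA, hFne, χ, s, hs, h⟩ := mem_regularDecomposition_iff.1 hF
  have hlim := (tendsto_gibbsPoint hw hFA hFne h (fun a => ψ (latticePt a)) b).comp
    (Real.tendsto_log_atTop.atTop_div_const hs)
  filter_upwards [Metric.tendsto_nhds.1 hlim ε hε, eventually_gt_atTop 0] with t ht ht0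
  -- With this multiple of `χ`, the exponent including `log t * lam` becomes `ψ + (log t / s) * (χ +
  -- s * lam)`.
  refine ⟨_, ⟨ψ + (Real.log t / s) • χ, rfl⟩, ?_⟩
  have hexponent : ∀ a, (ψ + (Real.log t / s) • χ) (latticePt a) + Real.log t * lam a =
      ψ (latticePt a) + Real.log t / s * (χ (latticePt a) + s * lam a) := by
    intro a
    simp only [AffineMap.coe_add, Pi.add_apply, AffineMap.coe_smul, Pi.smul_apply, smul_eq_mul]
    field_simp
    ring
  beta_reduce
  rw [dist_comm, gibbsPoint_degenerationWeights ht0]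
  simp only [hexponent]
  exact ht

/-- A section over the range of `T` extends to all of `W`. Then `id - T ∘ R` vanishes exactly on the
range, which turns membership in the range into a linear equation. -/
theorem LinearMap.exists_generalizedInverse {K V W : Type*} [DivisionRing K] [AddCommGroup V]
    [AddCommGroup W] [Module K V] [Module K W] (T : V →ₗ[K] W) :
    ∃ R : W →ₗ[K] V, ∀ v, T (R (T v)) = T v := by
  obtain ⟨s, hs⟩ := T.rangeRestrict.exists_rightInverse_of_surjective T.range_rangeRestrict
  obtain ⟨R, hR⟩ := LinearMap.exists_extend s
  refine ⟨R, fun v => ?_⟩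
  have h1 : R (T v) = s (T.rangeRestrict v) := LinearMap.congr_fun hR (T.rangeRestrict v)
  have h2 := congrArg Subtype.val (LinearMap.congr_fun hs (T.rangeRestrict v))
  rw [h1]
  simpa using h2

/-- A limit of normalized Gibbs weights with exponents `φ k + τ k * lam`, `τ k → ∞`, is given by
Gibbs weights on a face of the regular decomposition. -/
theorem exists_face_of_tendsto {κ : Type*} {l : Filter κ} [l.NeBot] (hw : ∀ a ∈ A, 0 < w a)
    {φ : κ → (Fin d → ℝ) →ᵃ[ℝ] ℝ} {τ : κ → ℝ} (hτ : Tendsto τ l atTop)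
    (hsum : ∀ k, ∑ a ∈ A, w a * Real.exp (φ k (latticePt a) + τ k * lam a) = 1)
    {p : (Fin d → ℤ) → ℝ} (hp : ∀ a ∈ A, Tendsto
      (fun k => w a * Real.exp (φ k (latticePt a) + τ k * lam a)) l (𝓝 (p a))) :
    ∃ F ∈ regularDecomposition A lam, ∃ ψ : (Fin d → ℝ) →ᵃ[ℝ] ℝ,
      (∀ a ∈ F, p a = w a * Real.exp (ψ (latticePt a))) ∧ (∀ a ∈ A, a ∉ F → p a = 0) ∧
        ∑ a ∈ F, p a = 1 := by
  classical
  have hp0 : ∀ a ∈ A, 0 ≤ p a := fun a ha =>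
    ge_of_tendsto' (hp a ha) fun k => (mul_pos (hw a ha) (Real.exp_pos _)).le
  have hpsum : ∑ a ∈ A, p a = 1 := by
    have := tendsto_finsetSum A hp
    simp only [hsum] at this
    exact tendsto_nhds_unique this tendsto_const_nhds
  set F := A.filter fun a => 0 < p a with hFdef
  have hFA : F ⊆ A := Finset.filter_subset _ _
  have hoff : ∀ a ∈ A, a ∉ F → p a = 0 := fun a ha haF =>
    le_antisymm (not_lt.1 fun h => haF (Finset.mem_filter.2 ⟨ha, h⟩)) (hp0 a ha)
  have hFsum : ∑ a ∈ F, p a = 1 := by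
    rw [← hpsum]
    exact Finset.sum_subset hFA hoff
  have hFne : F.Nonempty := by
    rw [Finset.nonempty_iff_ne_empty]
    intro h
    simp [h] at hFsum
  have hexp : ∀ a ∈ A, Tendsto (fun k => Real.exp (φ k (latticePt a) + τ k * lam a)) l
      (𝓝 (p a / w a)) := by
    intro a ha
    have hwa := (hw a ha).ne'
    have := (hp a ha).div_const (w a)
    simpa [hwa] using this
  -- `T` restricts affine forms to `F`, so `D u = 0` says that `u` is the restriction of an affine
  -- form, namely of `R u`.
  let T : ((Fin d → ℝ) →ᵃ[ℝ] ℝ) →ₗ[ℝ] (F → ℝ) :=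
    { toFun := fun φ a => φ (latticePt a)
      map_add' := fun _ _ => rfl
      map_smul' := fun _ _ => rfl }
  obtain ⟨R, hR⟩ := T.exists_generalizedInverse
  let D : (F → ℝ) →ₗ[ℝ] (F → ℝ) := LinearMap.id - T ∘ₗ R
  have hD : ∀ u, D u = u - T (R u) := fun u => rfl
  have hDc : Continuous D := D.continuous_of_finiteDimensional
  let lamF : F → ℝ := fun a => lam a
  let g : κ → F → ℝ := fun k => T (φ k) + τ k • lamF
  let γ : F → ℝ := fun a => Real.log (p a / w a)
  have hg : Tendsto g l (𝓝 γ) := by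
    rw [tendsto_pi_nhds]
    rintro ⟨a, ha⟩
    have hpa : 0 < p a := (Finset.mem_filter.1 ha).2
    have := (hexp a (hFA ha)).log (div_pos hpa (hw a (hFA ha))).ne'
    simp only [Real.log_exp] at this
    exact this
  have hDg : ∀ k, D (g k) = τ k • D lamF := by
    intro k
    have : D (T (φ k)) = 0 := by rw [hD, hR, sub_self]
    simp only [g, map_add, map_smul, this, zero_add]
  have hDgγ : Tendsto (fun k => D (g k)) l (𝓝 (D γ)) := (hDc.tendsto γ).comp hg
  -- `τ k • D lamF` converges although `τ k → ∞`; hence `lam` is affine on `F`.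
  have hDlam : D lamF = 0 := by
    have h1 : Tendsto (fun k => (τ k)⁻¹ • D (g k)) l (𝓝 ((0 : ℝ) • D γ)) :=
      (tendsto_inv_atTop_zero.comp hτ).smul hDgγ
    rw [zero_smul] at h1
    refine tendsto_nhds_unique (Tendsto.congr' ?_ h1) tendsto_const_nhds |>.symm
    filter_upwards [hτ.eventually_gt_atTop 0] with k hk
    rw [hDg, smul_smul, inv_mul_cancel₀ hk.ne', one_smul]
  have hDg0 : ∀ k, D (g k) = 0 := fun k => by rw [hDg, hDlam, smul_zero]
  have hDγ : D γ = 0 := by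
    simp only [hDg0] at hDgγ
    exact tendsto_nhds_unique hDgγ tendsto_const_nhds
  have hneg : ∀ a ∈ A, a ∉ F → ∀ᶠ k in l,
      (φ k - R (g k)) (latticePt a) + τ k * lam a < 0 := by
    intro a ha haF
    -- As a linear map on the finite-dimensional space `F → ℝ`, `ev` is continuous; no topology on
    -- affine forms is needed.
    let ev : (F → ℝ) →ₗ[ℝ] ℝ :=
      { toFun := fun u => R u (latticePt a)
        map_add' := fun u v => by simp
        map_smul' := fun r u => by simp }
    have h1 : Tendsto (fun k => R (g k) (latticePt a)) l (𝓝 (R γ (latticePt a))) :=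
      (ev.continuous_of_finiteDimensional.tendsto γ).comp hg
    have h2 : Tendsto (fun k => φ k (latticePt a) + τ k * lam a) l atBot := by
      refine Real.tendsto_exp_comp_nhds_zero.1 ?_
      simpa [hoff a ha haF] using hexp a ha
    filter_upwards [(h2.atBot_add h1.neg).eventually_lt_atBot 0] with k hk
    simp only [AffineMap.coe_sub, Pi.sub_apply]
    linarith
  -- A single large `k` certifies the face, with `χ = φ k - R (g k)` and `s = τ k`.
  obtain ⟨k, hk, hτk⟩ := (((eventually_all_finset A).2 fun a ha =>
    (eventually_imp_distrib_left.2 (hneg a ha))).and (hτ.eventually_gt_atTop 0)).exists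
  have hzero : ∀ a ∈ F, (φ k - R (g k)) (latticePt a) + τ k * lam a = 0 := by
    intro a ha
    have h1 : φ k (latticePt a) + τ k * lam a - R (g k) (latticePt a) = 0 :=
      congrFun (hDg0 k) ⟨a, ha⟩
    simp only [AffineMap.coe_sub, Pi.sub_apply]
    linarith
  refine ⟨F, mem_regularDecomposition_iff.2 ⟨hFA, hFne, φ k - R (g k), τ k, hτk,
    fun a ha => ?_⟩, R γ, fun a ha => ?_, hoff, hFsum⟩
  · by_cases haF : a ∈ F
    · have := hzero a haF
      exact ⟨this.le, fun _ => haF, fun _ => this⟩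
    · have := hk a ha haF
      exact ⟨this.le, fun h => absurd h this.ne, fun h => absurd h haF⟩
  · have h1 : Real.log (p a / w a) - R γ (latticePt a) = 0 := congrFun hDγ ⟨a, ha⟩
    have hwa := hw a (hFA ha)
    rw [← sub_eq_zero.1 h1, Real.exp_log (div_pos (Finset.mem_filter.1 ha).2 hwa)]
    field_simp

/-- For large `t` the degenerating orbit lies near the orbits of the faces of the regular
decomposition. -/
theorem eventually_forall_torusOrbit_exists_dist_le (hA : A.Nonempty) (hw : ∀ a ∈ A, 0 < w a)
    (b : (Fin d → ℤ) → E) {ε : ℝ} (hε : 0 < ε) : ∀ᶠ t in atTop,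
      ∀ x ∈ torusOrbit A (degenerationWeights w lam t) b,
        ∃ F ∈ regularDecomposition A lam, ∃ y ∈ torusOrbit F w b, dist x y ≤ ε := by
  by_contra hcon
  rw [eventually_atTop] at hcon
  push Not at hcon
  choose t ht x hx hfar using fun n : ℕ => hcon (n + 1)
  have ht0 : ∀ n, 0 < t n := fun n => lt_of_lt_of_le (by positivity) (ht n)
  -- Along an ultrafilter all bounded weights converge at once, without passing to subsequences.
  have hττ : Tendsto (fun n => Real.log (t n)) (hyperfilter ℕ : Filter ℕ) atTop := by
    refine Real.tendsto_log_atTop.comp (tendsto_atTop_mono ht ?_)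
    exact (tendsto_atTop_add_const_right _ 1 tendsto_natCast_atTop_atTop).mono_left
      Nat.hyperfilter_le_atTop
  choose φ hφ using hx
  let Z : ℕ → ℝ := fun n =>
    ∑ a ∈ A, w a * Real.exp (φ n (latticePt a) + Real.log (t n) * lam a)
  have hZ : ∀ n, 0 < Z n := fun n => sum_gibbsWeight_pos hA hw _
  -- Subtracting the constant `log (Z n)` normalizes the total weight to `1` and keeps the form
  -- affine.
  let φ' : ℕ → (Fin d → ℝ) →ᵃ[ℝ] ℝ := fun n =>
    φ n - AffineMap.const ℝ _ (Real.log (Z n))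
  let P : ℕ → (Fin d → ℤ) → ℝ := fun n a =>
    w a * Real.exp (φ' n (latticePt a) + Real.log (t n) * lam a)
  have hP : ∀ n a, P n a =
      (Z n)⁻¹ * (w a * Real.exp (φ n (latticePt a) + Real.log (t n) * lam a)) := by
    intro n a
    have : φ' n (latticePt a) + Real.log (t n) * lam a =
        φ n (latticePt a) + Real.log (t n) * lam a - Real.log (Z n) := by
      simp [φ']; ring
    simp only [P]
    rw [this, Real.exp_sub, Real.exp_log (hZ n)]
    ring
  have hPsum : ∀ n, ∑ a ∈ A, P n a = 1 := by
    intro n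
    simp only [hP]
    rw [← Finset.mul_sum]
    exact inv_mul_cancel₀ (hZ n).ne'
  have hP0 : ∀ n, ∀ a ∈ A, 0 ≤ P n a := fun n a ha => (mul_pos (hw a ha) (Real.exp_pos _)).le
  have hP1 : ∀ n, ∀ a ∈ A, P n a ≤ 1 := fun n a ha =>
    hPsum n ▸ Finset.single_le_sum (hP0 n) ha
  have hx : ∀ n, x n = ∑ a ∈ A, P n a • b a := by
    intro n
    rw [← hφ n]
    beta_reduce
    rw [gibbsPoint_degenerationWeights (ht0 n), gibbsPoint, Finset.smul_sum]
    exact Finset.sum_congr rfl fun a _ => by rw [hP, smul_smul]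
  have hlim : ∀ a, ∃ r, a ∈ A →
      Tendsto (fun n => P n a) (hyperfilter ℕ : Filter ℕ) (𝓝 r) := by
    intro a
    by_cases ha : a ∈ A
    · obtain ⟨r, -, hr⟩ := (isCompact_Icc (a := (0 : ℝ)) (b := 1)).ultrafilter_le_nhds
        ((hyperfilter ℕ).map fun n => P n a) (by
          rw [le_principal_iff]
          exact Filter.mem_map.2 (Filter.univ_mem' fun n => ⟨hP0 n a ha, hP1 n a ha⟩))
      exact ⟨r, fun _ => hr⟩
    · exact ⟨0, fun h => absurd h ha⟩
  choose p hp using hlim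
  obtain ⟨F, hF, ψ, hψ, hoff, hFsum⟩ := exists_face_of_tendsto hw hττ hPsum hp
  have hFA := (mem_regularDecomposition_iff.1 hF).1
  have hlimx : Tendsto x (hyperfilter ℕ : Filter ℕ)
      (𝓝 (gibbsPoint F w (fun a => ψ (latticePt a)) b)) := by
    have h1 : gibbsPoint F w (fun a => ψ (latticePt a)) b = ∑ a ∈ A, p a • b a := by
      rw [gibbsPoint_eq_of_mul (v := p) one_ne_zero fun a ha => by rw [hψ a ha, one_mul], hFsum,
        inv_one, one_smul]
      exact Finset.sum_subset hFA fun a ha haF => by rw [hoff a ha haF, zero_smul]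
    rw [h1, funext hx]
    exact tendsto_finsetSum A fun a ha => (hp a ha).smul_const (b a)
  obtain ⟨n, hn⟩ := (Metric.tendsto_nhds.1 hlimx ε hε).exists
  exact (hfar n F hF _ ⟨ψ, rfl⟩).not_gt hn

theorem totallyBounded_iUnion_torusOrbit (hw : ∀ a ∈ A, 0 < w a) (b : (Fin d → ℤ) → E) :
    TotallyBounded (⋃ F ∈ regularDecomposition A lam, torusOrbit F w b) := by
  refine TotallyBounded.subset ?_
    ((A.finite_toSet.image b).isCompact_convexHull ℝ).totallyBounded
  refine Set.iUnion₂_subset fun F hF => ?_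
  obtain ⟨hFA, hFne, -⟩ := mem_regularDecomposition_iff.1 hF
  rintro _ ⟨ψ, rfl⟩
  exact gibbsPoint_mem_convexHull hFne (fun a ha => hw a (hFA ha)) _ b fun a ha => hFA ha

/-- Toric degenerations of a patch converge to the regular control surface, for control points in
any normed space. -/
theorem hausdorffLimit_toricPatch (hw : ∀ a ∈ A, 0 < w a) (lam : (Fin d → ℤ) → ℝ)
    (b : (Fin d → ℤ) → E) :
    HausdorffLimit (fun t => toricPatch A (degenerationWeights w lam t) b)
      (controlSurface (regularDecomposition A lam) w b) := by
  rcases A.eq_empty_or_nonempty with rfl | hA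
  · refine fun ε _ => ⟨1, one_pos, fun t _ => ⟨fun x hx => ?_, fun y hy => ?_⟩⟩
    · simp [toricPatch, latticePolytope, latticeSet] at hx
    · obtain ⟨F, hF, -⟩ := Set.mem_iUnion₂.1 hy
      obtain ⟨hFA, ⟨a, ha⟩, -⟩ := mem_regularDecomposition_iff.1 hF
      exact absurd (hFA ha) (Finset.notMem_empty a)
  intro ε hε
  have hε3 : 0 < ε / 3 := by positivity
  set K : Set E := ⋃ F ∈ regularDecomposition A lam, torusOrbit F w b with hK
  -- Approximation of each limit point holds only from some `t` on, depending on the point; a finite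
  -- net makes this `t` uniform. The thirds of `ε` pay for passing from patch to orbit, from orbit
  -- to net, and from net to the degenerating orbit.
  obtain ⟨N, hNK, hNfin, hN⟩ := Metric.finite_approx_of_totallyBounded
    (totallyBounded_iUnion_torusOrbit (lam := lam) hw b) (ε / 3) hε3
  have hnet : ∀ᶠ t in atTop, ∀ y ∈ N,
      ∃ x ∈ torusOrbit A (degenerationWeights w lam t) b, dist y x < ε / 3 := by
    refine (eventually_all_finite hNfin).2 fun y hy => ?_
    obtain ⟨F, hF, hyF⟩ := Set.mem_iUnion₂.1 (hNK hy)
    exact eventually_exists_torusOrbit_dist_lt hw b hF hyF hε3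
  obtain ⟨M, hM⟩ := eventually_atTop.1 (hnet.and
    (eventually_forall_torusOrbit_exists_dist_le (lam := lam) hA hw b hε3))
  refine ⟨max M 1, by positivity, fun t ht => ?_⟩
  have ht0 : 0 < t := lt_of_lt_of_le one_pos ((le_max_right _ _).trans ht)
  obtain ⟨hnet, hnear⟩ := hM t ((le_max_left _ _).trans ht)
  constructor
  · intro x hx
    obtain ⟨x', hx', hxx'⟩ := Metric.mem_closure_iff.1
      (toricPatch_subset_closure_torusOrbit (degenerationWeights_pos hw ht0) b hx) _ hε3
    obtain ⟨F, hF, y, hy, hxy⟩ := hnear x' hx'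
    refine ⟨y, Set.mem_iUnion₂.2 ⟨F, hF, torusOrbit_subset_toricPatch
      (mem_regularDecomposition_iff.1 hF).2.1 b hy⟩, ?_⟩
    linarith [dist_triangle x x' y]
  · intro y hy
    obtain ⟨F, hF, hyF⟩ := Set.mem_iUnion₂.1 hy
    have hwF : ∀ a ∈ F, 0 < w a := fun a ha =>
      hw a ((mem_regularDecomposition_iff.1 hF).1 ha)
    obtain ⟨y', hy', hyy'⟩ := Metric.mem_closure_iff.1
      (toricPatch_subset_closure_torusOrbit hwF b hyF) _ hε3
    obtain ⟨z, hz, hy'z⟩ := Set.mem_iUnion₂.1 (hN (Set.mem_iUnion₂.2 ⟨F, hF, hy'⟩))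
    obtain ⟨x, hx, hzx⟩ := hnet z hz
    refine ⟨x, torusOrbit_subset_toricPatch hA b hx, ?_⟩
    linarith [dist_triangle y y' x, dist_triangle y' z x, Metric.mem_ball.1 hy'z]

end Degeneration

theorem theorem5p1 {d : ℕ} (A : Finset (Fin d → ℤ)) (w : (Fin d → ℤ) → ℝ)
    (hw : ∀ a ∈ A, 0 < w a) (lam : (Fin d → ℤ) → ℝ) :
    (∀ (n : ℕ) (b : (Fin d → ℤ) → EuclideanSpace ℝ (Fin n)),
      HausdorffLimit (fun t => toricPatch A (degenerationWeights w lam t) b)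
        (controlSurface (regularDecomposition A lam) w b)) ∧
    HausdorffLimit
      (fun t => toricPatch A (degenerationWeights w lam t) (simplexVertex A))
      (controlSurface (regularDecomposition A lam) w (simplexVertex A)) := by
  exact ⟨fun _ b => hausdorffLimit_toricPatch hw lam b, hausdorffLimit_toricPatch hw lam _⟩
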